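/- Let $\mathbf k$ be a field of characteristic $0$ with pairwise commuting derivations $\delta_1,\dots,\delta_m$ ($m\ge 0$), and let $\mathbf k\{y_1,\dots,y_n\}$ be the ring of differential polynomials, i.e. the polynomial ring over $\mathbf k$ in the derivatives $\Theta Y=\{\theta y_j\}$, where $\theta$ runs over the monoid $\Theta$ of derivative operators $\delta_1^{k_1}\cdots\delta_m^{k_m}$. Fix a ranking $\le$, that is, a total order on $\Theta Y$ such that $u\le\theta u$, and $v\le u$ implies $\theta v\le\theta u$, for all $\theta\in\Theta$ and $u,v\in\Theta Y$. The leader of a polynomial $f\notin\mathbf k$ is the highest derivative $u$ appearing in $f$, and its rank is $u^d$ with $d=\deg_u f$; ranks are compared first by $u$, then by $d$. We say that $f$ is algebraically reduced w.r.t. $g\notin\mathbf k$ with leader $u$ if $\deg_u f<\deg_u g$, and reduced w.r.t. $g$ if moreover no proper derivative $\theta u$, $\theta\ne 1$, appears in $f$. A set of polynomials outside $\mathbf k$ is (algebraically) autoreduced if each element is (algebraically) reduced w.r.t. all the others. Such a set $\mathbb A$ has lower rank than another one $\mathbb B$ if, at the first place where the increasing lists of ranks of their elements differ, $\mathbb A$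 has the smaller rank, or the list of $\mathbb B$ has ended and that of $\mathbb A$ has not. A characteristic set (respectively, an algebraic characteristic set) of a set $X$ of polynomials is an autoreduced (respectively, algebraically autoreduced) subset of $X$ of the lowest rank. (1) Let $P\subseteq Q$ be prime differential ideals of $\mathbf k\{y_1,\dots,y_n\}$, and let $\mathbb C_1$, $\mathbb C_2$ be characteristic sets of $P$, $Q$ w.r.t. $\le$. If $\mathbb C_1$ and $\mathbb C_2$ have the same set of leaders, then $P=Q$. (2) Let $V\subseteq\Theta Y$ be any set of derivatives, ordered by $\le$, let $P\subseteq Q$ be prime ideals of the polynomial ring $\mathbf k[V]$, and let $\mathbb C_1$, $\mathbb C_2$ be algebraic characteristic sets of $P$, $Q$ w.r.t. $\le$. If $\mathbb C_1$ and $\mathbb C_2$ have the same set of leaders, then $P=Q$. -/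

import Mathlib

noncomputable section

namespace DiffAlg

open MvPolynomial

/-! ### Derivatives and differential polynomials -/

/-- The derivatives `θ y_j`, where `θ = δ_1^{k_1} ⋯ δ_m^{k_m}` is a derivative operator, given by
its vector of exponents `op = (k_1, …, k_m)`, and `y_j` (with `j = var`) is one of the `n`
differential indeterminates. -/
@[ext]
structure DVar (m n : ℕ) where
  /-- the exponent vector of the derivative operator -/
  op : Fin m →₀ ℕ
  /-- the index of the differential indeterminate -/
  var : Fin n

/-- The action `θ₁ (θ₂ y_j) = (θ₁ θ₂) y_j` of derivative operators on derivatives. The monoid of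
derivative operators is written additively, through exponent vectors. -/
def DVar.act {m n : ℕ} (θ : Fin m →₀ ℕ) (u : DVar m n) : DVar m n := ⟨θ + u.op, u.var⟩

/-- The ring `k{y_1, …, y_n}` of differential polynomials, with `m` derivations. -/
abbrev DiffPoly (m n : ℕ) (k : Type*) [CommRing k] : Type _ := MvPolynomial (DVar m n) k

section Derivation

variable {σ k : Type*} [CommRing k]

/-- Application of a derivation of `k` to all coefficients of a polynomial. -/
def coeffDeriv (d : Derivation ℤ k k) (f : MvPolynomial σ k) : MvPolynomial σ k :=
  ∑ s ∈ f.support, monomial s (d (coeff s f))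

theorem coeff_coeffDeriv (d : Derivation ℤ k k) (f : MvPolynomial σ k) (s : σ →₀ ℕ) :
    coeff s (coeffDeriv d f) = d (coeff s f) := by
  classical
  simp only [coeffDeriv, coeff_sum, coeff_monomial, Finset.sum_ite_eq', mem_support_iff]
  split_ifs with h
  · rfl
  · simp [not_not.mp h]

theorem coeffDeriv_add (d : Derivation ℤ k k) (f g : MvPolynomial σ k) :
    coeffDeriv d (f + g) = coeffDeriv d f + coeffDeriv d g := by
  ext s
  simp [coeff_coeffDeriv]

theorem coeffDeriv_monomial (d : Derivation ℤ k k) (s : σ →₀ ℕ) (a : k) :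
    coeffDeriv d (monomial s a) = monomial s (d a) := by
  classical
  ext t
  simp only [coeff_coeffDeriv, coeff_monomial]
  split_ifs <;> simp

theorem coeffDeriv_mul (d : Derivation ℤ k k) (f g : MvPolynomial σ k) :
    coeffDeriv d (f * g) = f * coeffDeriv d g + g * coeffDeriv d f := by
  induction f using MvPolynomial.induction_on' with
  | add p q hp hq => simp only [add_mul, mul_add, coeffDeriv_add, hp, hq]; ring
  | monomial s a =>
    induction g using MvPolynomial.induction_on' with
    | add p q hp hq => simp only [add_mul, mul_add, coeffDeriv_add, hp, hq]; ring
    | monomial t b =>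
      simp only [monomial_mul, coeffDeriv_monomial, Derivation.leibniz, smul_eq_mul, map_add]
      rw [add_comm t s]

/-- `coeffDeriv` as a derivation. -/
def coeffDerivation (d : Derivation ℤ k k) :
    Derivation ℤ (MvPolynomial σ k) (MvPolynomial σ k) :=
  Derivation.mk' (AddMonoidHom.mk' (coeffDeriv d) (coeffDeriv_add d)).toIntLinearMap
    (fun f g => by simpa using coeffDeriv_mul d f g)

end Derivation

section Differential

variable {m n : ℕ} {k : Type*} [CommRing k]

/-- The derivation `δ_i` of `k{y_1, …, y_n}`: it extends the derivation `D i` of `k` and maps each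
derivative `u` to `δ_i u`. -/
def delta (D : Fin m → Derivation ℤ k k) (i : Fin m) :
    Derivation ℤ (DiffPoly m n k) (DiffPoly m n k) :=
  coeffDerivation (D i) +
    (mkDerivation k fun u : DVar m n => X (u.act (Finsupp.single i 1))).restrictScalars ℤ

theorem delta_C (D : Fin m → Derivation ℤ k k) (i : Fin m) (a : k) :
    delta D i (C a : DiffPoly m n k) = C (D i a) := by
  change coeffDeriv (D i) (monomial 0 a) + mkDerivation k _ (C a) = _
  rw [coeffDeriv_monomial, ← algebraMap_eq, Derivation.map_algebraMap, add_zero]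
  rfl

theorem delta_X (D : Fin m → Derivation ℤ k k) (i : Fin m) (u : DVar m n) :
    delta D i (X u : DiffPoly m n k) = X (u.act (Finsupp.single i 1)) := by
  change coeffDeriv (D i) (monomial _ 1) + mkDerivation k _ (X u) = _
  rw [coeffDeriv_monomial, mkDerivation_X]
  simp

/-- An ideal of `k{y_1, …, y_n}` is differential if it is stable under all the `δ_i`. -/
def IsDifferentialIdeal (D : Fin m → Derivation ℤ k k) (I : Ideal (DiffPoly m n k)) : Prop :=
  ∀ i : Fin m, ∀ f ∈ I, delta D i f ∈ I

end Differential

/-- A ranking: a total order on the derivatives with `θ u ≥ u` and `u ≥ v → θ u ≥ θ v`. -/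
def IsRanking (m n : ℕ) [LinearOrder (DVar m n)] : Prop :=
  (∀ (θ : Fin m →₀ ℕ) (u : DVar m n), u ≤ u.act θ) ∧
    ∀ (θ : Fin m →₀ ℕ) (u v : DVar m n), v ≤ u → v.act θ ≤ u.act θ

/-! ### Leaders, ranks, reducedness -/

section Rank

variable {σ k : Type*} [LinearOrder σ] [CommRing k]

/-- `u` is the leader of `f`: the highest variable appearing in `f`. An `f` in `k` has none. -/
def IsLeader (f : MvPolynomial σ k) (u : σ) : Prop := IsGreatest {v | v ∈ f.vars} u

/-- The set of leaders of the elements of `A`. -/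
def leaders (A : Set (MvPolynomial σ k)) : Set σ := {u | ∃ f ∈ A, IsLeader f u}

/-- The set of ranks of the elements of `A`; the rank `u ^ d`, where `u` is the leader of `f` and
`d` is the degree of `f` in `u`, is encoded as the pair `(u, d)`. -/
def ranks (A : Set (MvPolynomial σ k)) : Set (σ × ℕ) :=
  {r | ∃ f ∈ A, IsLeader f r.1 ∧ f.degreeOf r.1 = r.2}

/-- Comparison of ranks: `u₁ ^ d₁ < u₂ ^ d₂` iff `u₁ < u₂`, or `u₁ = u₂` and `d₁ < d₂`. -/
def RankLT (r s : σ × ℕ) : Prop := r.1 < s.1 ∨ r.1 = s.1 ∧ r.2 < s.2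

/-- `A` has lower rank than `B`, for (algebraically) autoreduced sets, whose elements have pairwise
distinct leaders: at the first place where the increasing lists of the ranks of `A` and of `B`
differ, either `A` has the smaller rank `r`, or the list of `B` has ended and that of `A` goes on
with `r`. -/
def LowerRank (A B : Set (MvPolynomial σ k)) : Prop :=
  ∃ r ∈ ranks A, r ∉ ranks B ∧ ∀ s, RankLT s r → (s ∈ ranks A ↔ s ∈ ranks B)

/-- `f` is algebraically reduced w.r.t. `g`: its degree in the leader of `g` is smaller than that
of `g`. -/
def IsAlgReduced (f g : MvPolynomial σ k) : Prop :=
  ∀ u, IsLeader g u → f.degreeOf u < g.degreeOf u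

/-- `A` consists of polynomials outside `k`, each of which is reduced, in the sense of `red`,
w.r.t. all the others. -/
def IsAutoreducedFor (red : MvPolynomial σ k → MvPolynomial σ k → Prop)
    (A : Set (MvPolynomial σ k)) : Prop :=
  (∀ f ∈ A, f ∉ Set.range (C : k → MvPolynomial σ k)) ∧ ∀ f ∈ A, ∀ g ∈ A, f ≠ g → red f g

/-- `A` is a subset of `S` of the lowest rank among those autoreduced in the sense of `red`. -/
def IsCharSetFor (red : MvPolynomial σ k → MvPolynomial σ k → Prop)
    (A S : Set (MvPolynomial σ k)) : Prop :=
  A ⊆ S ∧ IsAutoreducedFor red A ∧ ∀ B ⊆ S, IsAutoreducedFor red B → ¬ LowerRank B A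

/-- `A` is an algebraic characteristic set of `S`: an algebraically autoreduced subset of the
lowest rank. -/
def IsAlgCharSet (A S : Set (MvPolynomial σ k)) : Prop := IsCharSetFor IsAlgReduced A S

end Rank

section DifferentialRank

variable {m n : ℕ} [LinearOrder (DVar m n)] {k : Type*} [CommRing k]

/-- `f` is partially reduced w.r.t. `g`: no proper derivative of the leader of `g` appears in
`f`. -/
def IsPartiallyReduced (f g : DiffPoly m n k) : Prop :=
  ∀ u, IsLeader g u → ∀ θ : Fin m →₀ ℕ, θ ≠ 0 → u.act θ ∉ f.vars

/-- `f` is reduced w.r.t. `g`: partially and algebraically reduced. -/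
def IsReduced (f g : DiffPoly m n k) : Prop := IsPartiallyReduced f g ∧ IsAlgReduced f g

/-- `A` is a (differential) characteristic set of `S`: an autoreduced subset of the lowest
rank. -/
def IsCharSet (A S : Set (DiffPoly m n k)) : Prop := IsCharSetFor IsReduced A S

end DifferentialRank

end DiffAlg

end

/-! Let N be the set of variables that are not leaders of the characteristic sets (in the
differential case, not derivatives of leaders). Modulo P every variable outside N is algebraic over
the smaller ones: an element of the characteristic set gives an equation for its leader u, applying
θ gives one for θu with the same separant, and the separant lies outside P by minimality of rank in
characteristic 0. Since rankings are well-orders, `k[V]/P` is then algebraic over `k[N]`. A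
polynomial of Q in the variables of N is reduced w.r.t. the characteristic set of Q, hence zero. But
some g in Q outside P would divide, modulo P, a nonzero element of `k[N]`, and that element would
lie in Q.

`eq_of_le_of_algebraic` is the common argument. `eq_zero_of_forall_red` and `pderiv_leader_notMem`
supply its hypotheses for an abstract relation `red`, so that they serve both notions of
reducedness. -/

namespace DiffAlg

open MvPolynomial

/-! ### Algebraicity modulo a prime ideal -/

section Algebraic

variable {σ k : Type*} [LinearOrder σ] [Field k]

/-- Let `ψ` be a ring homomorphism from a polynomial ring to a domain `A`, defined over a
subring `R` on the coefficients. If the images of the variables smaller than `v` are algebraic, so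
is the image of `v`, provided `ψ` annihilates some `f` without variables above `v`, but not the
derivative of `f` at `v`. -/
theorem isAlgebraic_of_pderiv_ne_zero {R A : Type*} [CommRing R] [IsDomain R] [CommRing A]
    [IsDomain A] [Algebra R A] (ψ : MvPolynomial σ k →+* A) (ι : k →+* R)
    (hψ : ∀ a, ψ (C a) = algebraMap R A (ι a)) {v : σ} (hlt : ∀ w < v, IsAlgebraic R (ψ (X w)))
    {f : MvPolynomial σ k} (hfv : f ∈ supported k (Set.Iic v)) (hf : ψ f = 0)
    (hsep : ψ (pderiv v f) ≠ 0) : IsAlgebraic R (ψ (X v)) := by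
  classical
  let S := Subalgebra.algebraicClosure R A
  -- Polynomials in variables up to `v` become univariate in `v`; the value at variables above `v`
  -- is irrelevant.
  let φ : MvPolynomial σ k →+* Polynomial S :=
    eval₂Hom (Polynomial.C.comp ((algebraMap R S).comp ι)) fun w =>
      if h : w < v then Polynomial.C ⟨ψ (X w), hlt w h⟩ else Polynomial.X
  have key : ∀ g ∈ supported k (Set.Iic v), Polynomial.aeval (ψ (X v)) (φ g) = ψ g ∧
      Polynomial.aeval (ψ (X v)) (Polynomial.derivative (φ g)) = ψ (pderiv v g) := by
    intro g hg
    rw [supported_eq_adjoin_X] at hg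
    induction hg using Algebra.adjoin_induction with
    | mem g hg =>
      obtain ⟨w, hw, rfl⟩ := hg
      rcases (show w ≤ v from hw).lt_or_eq with h | rfl
      · have : φ (X w) = Polynomial.C ⟨ψ (X w), hlt w h⟩ := by simp [φ, h]
        rw [this, pderiv_X_of_ne h.ne, Polynomial.aeval_C, Polynomial.derivative_C, map_zero,
          map_zero]
        exact ⟨rfl, rfl⟩
      · have : φ (X w) = Polynomial.X := by simp [φ]
        rw [this]
        simp
    | algebraMap r =>
      have : φ (C r) = Polynomial.C (algebraMap R S (ι r)) := by simp [φ]
      rw [algebraMap_eq, pderiv_C, this, Polynomial.aeval_C, Polynomial.derivative_C, map_zero,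
        map_zero, hψ]
      exact ⟨rfl, rfl⟩
    | add g h _ _ hg hh => simp only [map_add, hg, hh, and_self]
    | mul g h _ _ hg hh =>
      simp only [map_mul, map_add, Polynomial.derivative_mul, pderiv_mul, hg, hh, and_self]
  -- `φ f` is nonzero because its derivative does not vanish at `ψ (X v)`; algebraicity over `S`
  -- then descends to `R` by transitivity.
  have hx : IsAlgebraic S (ψ (X v)) :=
    ⟨φ f, fun h0 => hsep (by rw [← (key f hfv).2, h0, map_zero, map_zero]),
      by rw [(key f hfv).1, hf]⟩
  exact hx.restrictScalars R

/-- Let `P ≤ Q` be prime ideals of a polynomial ring in well-ordered variables. If every variable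
outside `N` is separably algebraic modulo `P` over the smaller ones and `Q` contains no nonzero
polynomial in the variables of `N`, then `P = Q`. -/
theorem eq_of_le_of_algebraic [WellFoundedLT σ] {P Q : Ideal (MvPolynomial σ k)} [P.IsPrime]
    (hPQ : P ≤ Q) (N : Set σ)
    (hP : ∀ v ∉ N, ∃ f ∈ P, f ∈ supported k (Set.Iic v) ∧ pderiv v f ∉ P)
    (hQ : ∀ f ∈ Q, f ∈ supported k N → f = 0) : P = Q := by
  let R := supported k N
  have hX : ∀ v, IsAlgebraic R (Ideal.Quotient.mk P (X v)) := by
    intro v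
    induction v using WellFoundedLT.induction with
    | ind v ih =>
      by_cases hv : v ∈ N
      · exact isAlgebraic_algebraMap (⟨X v, X_mem_supported.2 hv⟩ : R)
      · obtain ⟨f, hfP, hfv, hsep⟩ := hP v hv
        refine isAlgebraic_of_pderiv_ne_zero (Ideal.Quotient.mk P) (algebraMap k R) (fun _ => rfl) ih
          hfv (Ideal.Quotient.eq_zero_iff_mem.2 hfP) ?_
        rwa [Ne, Ideal.Quotient.eq_zero_iff_mem]
  have hall : ∀ g, IsAlgebraic R (Ideal.Quotient.mk P g) := by
    intro g
    induction g using MvPolynomial.induction_on with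
    | C a => exact isAlgebraic_algebraMap (algebraMap k R a)
    | add p q hp hq => rw [map_add]; exact hp.add hq
    | mul_X p v hp => rw [map_mul]; exact hp.mul (hX v)
  refine le_antisymm hPQ fun g hg => ?_
  by_contra hgP
  have hg0 : Ideal.Quotient.mk P g ≠ 0 := by rwa [Ne, Ideal.Quotient.eq_zero_iff_mem]
  -- The constant term of a suitable algebraic equation for `g` is a nonzero multiple of `g` modulo
  -- `P`.
  obtain ⟨r, hr0, a, ha⟩ := (hall g).exists_nonzero_dvd (mem_nonZeroDivisors_of_ne_zero hg0)
  obtain ⟨h, rfl⟩ := Ideal.Quotient.mk_surjective a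
  have hmem : (r : MvPolynomial σ k) - g * h ∈ P := by
    rw [← Ideal.Quotient.eq, map_mul]
    exact ha
  have hrQ : (r : MvPolynomial σ k) ∈ Q := by
    have := Q.add_mem (hPQ hmem) (Q.mul_mem_right h hg)
    rwa [sub_add_cancel] at this
  exact hr0 (Subtype.ext (hQ r hrQ r.2))

end Algebraic

/-! ### Degrees of partial derivatives -/

section PDeriv

variable {σ k : Type*} [CommRing k]

theorem degreeOf_pderiv_le (u v : σ) (f : MvPolynomial σ k) :
    (pderiv u f).degreeOf v ≤ f.degreeOf v := by
  classical
  rw [degreeOf_le_iff]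
  intro s hs
  rw [mem_support_iff, coeff_pderiv] at hs
  have := degreeOf_le_iff.1 (le_refl (f.degreeOf v)) _
    (mem_support_iff.2 (left_ne_zero_of_mul hs))
  simp only [Finsupp.coe_add, Pi.add_apply] at this
  omega

theorem degreeOf_pderiv_lt {u : σ} {f : MvPolynomial σ k} (hu : u ∈ f.vars) :
    (pderiv u f).degreeOf u < f.degreeOf u := by
  classical
  rw [degreeOf_lt_iff (Nat.pos_of_ne_zero (mem_vars_iff_degreeOf_ne_zero.1 hu))]
  intro s hs
  rw [mem_support_iff, coeff_pderiv] at hs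
  have := degreeOf_le_iff.1 (le_refl (f.degreeOf u)) _
    (mem_support_iff.2 (left_ne_zero_of_mul hs))
  simp only [Finsupp.coe_add, Pi.add_apply, Finsupp.single_eq_same] at this
  omega

/-- A monomial `s` containing `u` contributes its coefficient times the exponent of `u`, nonzero in
characteristic 0, and no other monomial interferes. -/
theorem pderiv_ne_zero [IsDomain k] [CharZero k] {u : σ} {f : MvPolynomial σ k}
    (hu : u ∈ f.vars) : pderiv u f ≠ 0 := by
  classical
  obtain ⟨s, hs, hsu⟩ := (mem_vars_iff_mem_support u).1 hu
  have hle : Finsupp.single u 1 ≤ s :=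
    Finsupp.single_le_iff.2 (Nat.one_le_iff_ne_zero.2 (Finsupp.mem_support_iff.1 hsu))
  intro h0
  have h := coeff_pderiv (i := u) f (s - Finsupp.single u 1)
  rw [h0, coeff_zero, tsub_add_cancel_of_le hle] at h
  exact mul_ne_zero (mem_support_iff.1 hs) (Nat.cast_add_one_ne_zero _) h.symm

end PDeriv

theorem notMem_range_C_of_mem {σ k : Type*} [Field k] {P : Ideal (MvPolynomial σ k)} (hP : P ≠ ⊤)
    {f : MvPolynomial σ k} (hf : f ∈ P) (hf0 : f ≠ 0) :
    f ∉ Set.range (C : k → MvPolynomial σ k) := by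
  rintro ⟨a, rfl⟩
  have ha : a ≠ 0 := by rintro rfl; simp at hf0
  exact hP (P.eq_top_of_isUnit_mem hf ((isUnit_iff_ne_zero.2 ha).map C))

/-! ### Characteristic sets for a general notion of reducedness -/

section CharSet

variable {σ k : Type*} [LinearOrder σ]

theorem IsLeader.degreeOf_pos [CommRing k] {f : MvPolynomial σ k} {u : σ} (h : IsLeader f u) :
    0 < f.degreeOf u :=
  Nat.pos_of_ne_zero (mem_vars_iff_degreeOf_ne_zero.1 h.1)

theorem IsLeader.eq [CommRing k] {f : MvPolynomial σ k} {u v : σ} (hu : IsLeader f u)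
    (hv : IsLeader f v) : u = v :=
  IsGreatest.unique hu hv

theorem IsLeader.mem_supported [CommRing k] {f : MvPolynomial σ k} {u : σ} (h : IsLeader f u) :
    f ∈ supported k (Set.Iic u) :=
  MvPolynomial.mem_supported.2 fun _ hv => h.2 hv

theorem exists_isLeader [CommRing k] {f : MvPolynomial σ k}
    (hf : f ∉ Set.range (C : k → MvPolynomial σ k)) : ∃ u, IsLeader f u := by
  have hne : f.vars.Nonempty := by
    rw [Finset.nonempty_iff_ne_empty]
    intro h
    refine hf ⟨coeff 0 f, ?_⟩
    have : f ∈ supported k (∅ : Set σ) := MvPolynomial.mem_supported.2 (by simp [h])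
    rw [supported_empty, Algebra.mem_bot] at this
    obtain ⟨a, rfl⟩ := this
    simp [algebraMap_eq]
  exact ⟨f.vars.max' hne, f.vars.isGreatest_max' hne⟩

/-- An element of a proper ideal that is reduced w.r.t. a characteristic set vanishes. -/
theorem eq_zero_of_forall_red [Field k] {red : MvPolynomial σ k → MvPolynomial σ k → Prop}
    (hAlg : ∀ f g, red f g → IsAlgReduced f g)
    (hLow : ∀ f g u, IsLeader g u → (∀ v ∈ f.vars, v ≤ u) → f.degreeOf u < g.degreeOf u → red f g)
    {P : Ideal (MvPolynomial σ k)} (hP : P ≠ ⊤) {A : Set (MvPolynomial σ k)}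
    (hA : IsCharSetFor red A (P : Set (MvPolynomial σ k)))
    {f : MvPolynomial σ k} (hf : f ∈ P) (hred : ∀ c ∈ A, red f c) : f = 0 := by
  by_contra hf0
  have hfC := notMem_range_C_of_mem hP hf hf0
  obtain ⟨w, hw⟩ := exists_isLeader hfC
  obtain ⟨hAP, ⟨hAC, hAred⟩, hmin⟩ := hA
  -- If `f` were nonzero, adding it to the elements of `A` with leader below `w` would give an
  -- autoreduced set of lower rank: first difference at the rank of `f`.
  refine hmin (insert f {c ∈ A | ∃ u, IsLeader c u ∧ u < w}) ?_ ⟨?_, ?_⟩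
    ⟨(w, f.degreeOf w), ⟨f, Or.inl rfl, hw, rfl⟩, ?_, ?_⟩
  · rintro g (rfl | hg)
    exacts [hf, hAP hg.1]
  · rintro g (rfl | hg)
    exacts [hfC, hAC g hg.1]
  · rintro g (rfl | ⟨hg, u, hu, huw⟩) h (rfl | ⟨hh, -⟩) hne
    · exact absurd rfl hne
    · exact hred h hh
    · refine hLow g h w hw (fun v hv => (hu.2 hv).trans huw.le) ?_
      have : g.degreeOf w = 0 := by
        by_contra h0
        exact huw.not_ge (hu.2 (mem_vars_iff_degreeOf_ne_zero.2 h0))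
      rw [this]
      exact hw.degreeOf_pos
    · exact hAred g hg h hh hne
  · rintro ⟨c, hc, hcw, hdeg⟩
    exact (hAlg _ _ (hred c hc) w hcw).ne hdeg.symm
  · rintro ⟨s, d⟩ hs
    constructor
    · rintro ⟨g, rfl | hg, hgs, hgd⟩
      · obtain rfl := hw.eq hgs
        simp only at hgd
        simp [RankLT, hgd] at hs
      · exact ⟨g, hg.1, hgs, hgd⟩
    -- An element of `A` of smaller rank has leader below `w`, so it was kept: with leader `w` its
    -- degree would exceed that of `f`.
    · rintro ⟨c, hc, hcs, hcd⟩
      rcases hs with hs | ⟨rfl, hd⟩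
      · exact ⟨c, Or.inr ⟨hc, s, hcs, hs⟩, hcs, hcd⟩
      · have := hAlg _ _ (hred c hc) s hcs
        simp only at hcd hd
        omega

/-- The separants of a characteristic set of a proper ideal lie outside the ideal. -/
theorem pderiv_leader_notMem [Field k] [CharZero k]
    {red : MvPolynomial σ k → MvPolynomial σ k → Prop}
    (hAlg : ∀ f g, red f g → IsAlgReduced f g)
    (hLow : ∀ f g u, IsLeader g u → (∀ v ∈ f.vars, v ≤ u) → f.degreeOf u < g.degreeOf u → red f g)
    (hMono : ∀ f f' g, (∀ v, f'.degreeOf v ≤ f.degreeOf v) → red f g → red f' g)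
    {P : Ideal (MvPolynomial σ k)} (hP : P ≠ ⊤) {A : Set (MvPolynomial σ k)}
    (hA : IsCharSetFor red A (P : Set (MvPolynomial σ k)))
    {c : MvPolynomial σ k} (hc : c ∈ A) {u : σ} (hu : IsLeader c u) : pderiv u c ∉ P := by
  intro hmem
  refine pderiv_ne_zero hu.1 (eq_zero_of_forall_red hAlg hLow hP hA hmem fun c' hc' => ?_)
  by_cases h : c = c'
  · subst h
    -- Differentiation introduces no new variable and lowers the degree in `u`, so the separant is
    -- reduced even w.r.t. `c` itself.
    refine hLow _ _ u hu (fun v hv => hu.2 ?_) (degreeOf_pderiv_lt hu.1)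
    rw [mem_vars_iff_degreeOf_ne_zero] at hv
    exact mem_vars_iff_degreeOf_ne_zero.2 fun h0 =>
      hv (Nat.le_zero.1 (h0 ▸ degreeOf_pderiv_le u v c))
  · exact hMono _ _ _ (fun v => degreeOf_pderiv_le u v c) (hA.2.1.2 c hc c' hc' h)

theorem IsAlgReduced.mono [CommRing k] {f f' g : MvPolynomial σ k}
    (h : ∀ v, f'.degreeOf v ≤ f.degreeOf v) (hf : IsAlgReduced f g) : IsAlgReduced f' g :=
  fun u hu => (h u).trans_lt (hf u hu)

theorem isAlgReduced_of_degreeOf_lt [CommRing k] {f g : MvPolynomial σ k} {u : σ}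
    (hu : IsLeader g u) (h : f.degreeOf u < g.degreeOf u) : IsAlgReduced f g := by
  intro v hv
  rwa [← hu.eq hv]

theorem isAlgReduced_of_notMem_vars [CommRing k] {f g : MvPolynomial σ k}
    (h : ∀ u, IsLeader g u → u ∉ f.vars) : IsAlgReduced f g := by
  intro u hu
  have := h u hu
  rw [mem_vars_iff_degreeOf_ne_zero, not_not] at this
  rw [this]
  exact hu.degreeOf_pos

/-- Prime ideals `P ≤ Q` whose algebraic characteristic sets have the same leaders coincide. -/
theorem eq_of_leaders_eq_of_isAlgCharSet [Field k] [CharZero k] [WellFoundedLT σ]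
    {P Q : Ideal (MvPolynomial σ k)} [P.IsPrime] [hQ : Q.IsPrime] {A B : Set (MvPolynomial σ k)}
    (hA : IsAlgCharSet A (P : Set (MvPolynomial σ k)))
    (hB : IsAlgCharSet B (Q : Set (MvPolynomial σ k)))
    (hAB : leaders A = leaders B) (hPQ : P ≤ Q) : P = Q := by
  have hLow : ∀ (f g : MvPolynomial σ k) (u : σ), IsLeader g u → (∀ v ∈ f.vars, v ≤ u) →
      f.degreeOf u < g.degreeOf u → IsAlgReduced f g :=
    fun _ _ _ hu _ => isAlgReduced_of_degreeOf_lt hu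
  refine eq_of_le_of_algebraic hPQ (leaders A)ᶜ (fun v hv => ?_) fun f hf hfN => ?_
  · obtain ⟨c, hc, hcv⟩ := not_not.1 hv
    exact ⟨c, hA.1 hc, hcv.mem_supported, pderiv_leader_notMem (fun _ _ => id) hLow
      (fun _ _ _ => IsAlgReduced.mono) (Ideal.IsPrime.ne_top ‹_›) hA hc hcv⟩
  · refine eq_zero_of_forall_red (fun _ _ => id) hLow hQ.ne_top hB hf fun c hc =>
      isAlgReduced_of_notMem_vars fun u hu hmem => mem_supported.1 hfN hmem ?_
    rw [hAB]
    exact ⟨c, hc, hu⟩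

end CharSet

/-! ### Rankings as well-orders -/

section Ranking

variable {m n : ℕ}

theorem DVar.zero_act (u : DVar m n) : u.act 0 = u := by
  simp [DVar.act]

theorem DVar.act_act (θ η : Fin m →₀ ℕ) (u : DVar m n) : (u.act θ).act η = u.act (θ + η) := by
  simp only [DVar.act, DVar.mk.injEq, and_true]
  abel

theorem DVar.act_injective (θ : Fin m →₀ ℕ) : Function.Injective (DVar.act (n := n) θ) := by
  intro u v h
  simp only [DVar.act, DVar.mk.injEq, add_right_inj] at h
  exact DVar.ext h.1 h.2

theorem DVar.act_ne_self {θ : Fin m →₀ ℕ} (hθ : θ ≠ 0) (u : DVar m n) : u.act θ ≠ u := by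
  intro h
  exact hθ (by simpa [DVar.act, DVar.ext_iff] using h)

variable [LinearOrder (DVar m n)]

theorem IsRanking.lt_act (h : IsRanking m n) {θ : Fin m →₀ ℕ} (hθ : θ ≠ 0) (u : DVar m n) :
    u < u.act θ :=
  (h.1 θ u).lt_of_ne (DVar.act_ne_self hθ u).symm

/-- Rankings are well-orders, by Dickson's lemma. -/
theorem IsRanking.wellFoundedLT (h : IsRanking m n) : WellFoundedLT (DVar m n) := by
  refine ⟨RelEmbedding.wellFounded_iff_isEmpty.2 ⟨fun f => ?_⟩⟩
  have hwqo := (wellQuasiOrdered_le (α := Fin m →₀ ℕ)).prod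
    (Finite.wellQuasiOrdered (α := Fin n) (· = ·))
  -- In an infinite descending sequence, some later term would be a derivative of an earlier one,
  -- hence not smaller.
  obtain ⟨a, b, hab, hop, hvar⟩ := hwqo fun i => ((f i).op, (f i).var)
  have hact : (f a).act ((f b).op - (f a).op) = f b :=
    DVar.ext (tsub_add_cancel_of_le hop) hvar
  have hle : f a ≤ f b := hact ▸ h.1 _ (f a)
  exact hle.not_gt (f.map_rel_iff.2 hab)

end Ranking

/-! ### Differentiating elements of a differential ideal -/

section Differential

variable {m n : ℕ} [LinearOrder (DVar m n)] {k : Type*} [CommRing k]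

/-- If the variables of `f` are at most `u`, then `δ_i f` is of degree at most one in `δ_i u`, with
the same separant as `f`. -/
theorem IsRanking.delta_supported_Iic (h : IsRanking m n) (D : Fin m → Derivation ℤ k k)
    (i : Fin m) {u : DVar m n} {f : DiffPoly m n k} (hf : f ∈ supported k (Set.Iic u)) :
    delta D i f ∈ supported k (Set.Iic (u.act (Finsupp.single i 1))) ∧
      pderiv (u.act (Finsupp.single i 1)) (delta D i f) = pderiv u f := by
  classical
  have hlt : u < u.act (Finsupp.single i 1) := h.lt_act (by simp) u
  have hle : supported k (Set.Iic u) ≤ supported k (Set.Iic (u.act (Finsupp.single i 1))) :=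
    supported_mono (Set.Iic_subset_Iic.2 hlt.le)
  -- Since `δ_i u` exceeds `u`, only the differentiated factors in the Leibniz rule can contain it.
  have hzero : ∀ g ∈ supported k (Set.Iic u), pderiv (u.act (Finsupp.single i 1)) g = 0 :=
    fun g hg => pderiv_eq_zero_of_notMem_vars fun hmem => hlt.not_ge (mem_supported.1 hg hmem)
  have hf' := hf
  rw [supported_eq_adjoin_X] at hf
  induction hf using Algebra.adjoin_induction with
  | mem g hg =>
    obtain ⟨v, hv, rfl⟩ := hg
    rw [delta_X]
    refine ⟨Algebra.subset_adjoin ⟨_, h.2 _ _ _ hv, rfl⟩, ?_⟩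
    by_cases hvu : v = u
    · rw [hvu, pderiv_X_self, pderiv_X_self]
    · rw [pderiv_X_of_ne hvu, pderiv_X_of_ne fun h' => hvu (DVar.act_injective _ h')]
  | algebraMap r =>
    rw [algebraMap_eq, delta_C, pderiv_C, pderiv_C, ← algebraMap_eq]
    exact ⟨Subalgebra.algebraMap_mem _ _, rfl⟩
  | add p q hp hq ihp ihq =>
    obtain ⟨hp₁, hp₂⟩ := ihp hp
    obtain ⟨hq₁, hq₂⟩ := ihq hq
    rw [map_add, map_add, map_add, hp₂, hq₂]
    exact ⟨add_mem hp₁ hq₁, rfl⟩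
  | mul p q hp hq ihp ihq =>
    obtain ⟨hp₁, hp₂⟩ := ihp hp
    obtain ⟨hq₁, hq₂⟩ := ihq hq
    rw [Derivation.leibniz, smul_eq_mul, smul_eq_mul, map_add, pderiv_mul, pderiv_mul, pderiv_mul,
      hp₂, hq₂, hzero p hp, hzero q hq]
    exact ⟨add_mem (mul_mem (hle hp) hq₁) (mul_mem (hle hq) hp₁), by ring⟩

/-- Applying the derivative operator `θ` to an element of a differential ideal whose variables are
at most `u` yields an element whose variables are at most `θ u`, with the same separant. -/
theorem IsRanking.exists_mem_supported_Iic_act (h : IsRanking m n) {D : Fin m → Derivation ℤ k k}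
    {I : Ideal (DiffPoly m n k)} (hI : IsDifferentialIdeal D I) (θ : Fin m →₀ ℕ) (u : DVar m n)
    {f : DiffPoly m n k} (hfI : f ∈ I) (hf : f ∈ supported k (Set.Iic u)) :
    ∃ g ∈ I, g ∈ supported k (Set.Iic (u.act θ)) ∧ pderiv (u.act θ) g = pderiv u f := by
  induction θ using Finsupp.induction_linear generalizing u f with
  | zero => exact ⟨f, hfI, by rwa [DVar.zero_act], by rw [DVar.zero_act]⟩
  | add θ η ihθ ihη =>
    obtain ⟨g, hgI, hg, hgf⟩ := ihθ u hfI hf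
    obtain ⟨g', hgI', hg', hgf'⟩ := ihη (u.act θ) hgI hg
    rw [DVar.act_act] at hg' hgf'
    exact ⟨g', hgI', hg', hgf'.trans hgf⟩
  | single i d =>
    induction d with
    | zero => exact ⟨f, hfI, by rwa [Finsupp.single_zero, DVar.zero_act],
        by rw [Finsupp.single_zero, DVar.zero_act]⟩
    | succ d ih =>
      obtain ⟨g, hgI, hg, hgf⟩ := ih
      obtain ⟨hδ, hδ'⟩ := h.delta_supported_Iic D i hg
      rw [DVar.act_act, ← Finsupp.single_add] at hδ hδ'
      exact ⟨delta D i g, hI i g hgI, hδ, hδ'.trans hgf⟩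

theorem IsReduced.mono {f f' g : DiffPoly m n k} (h : ∀ v, f'.degreeOf v ≤ f.degreeOf v)
    (hf : IsReduced f g) : IsReduced f' g := by
  refine ⟨fun u hu θ hθ hmem => hf.1 u hu θ hθ ?_, hf.2.mono h⟩
  rw [mem_vars_iff_degreeOf_ne_zero] at hmem ⊢
  exact fun h0 => hmem (Nat.le_zero.1 (h0 ▸ h _))

/-- Proper derivatives of `u` lie strictly above `u`, so partial reducedness is automatic. -/
theorem IsRanking.isReduced_of_degreeOf_lt (h : IsRanking m n) {f g : DiffPoly m n k}
    {u : DVar m n} (hu : IsLeader g u) (hf : ∀ v ∈ f.vars, v ≤ u)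
    (hdeg : f.degreeOf u < g.degreeOf u) : IsReduced f g := by
  refine ⟨fun v hv θ hθ hmem => ?_, isAlgReduced_of_degreeOf_lt hu hdeg⟩
  rw [← hu.eq hv] at hmem
  exact (h.lt_act hθ u).not_ge (hf _ hmem)

end Differential

/-- Prime differential ideals `P ≤ Q` whose characteristic sets have the same leaders coincide. -/
theorem IsRanking.eq_of_leaders_eq_of_isCharSet {m n : ℕ} [LinearOrder (DVar m n)] {k : Type*}
    [Field k] [CharZero k] (h : IsRanking m n) {D : Fin m → Derivation ℤ k k}
    {P Q : Ideal (DiffPoly m n k)} [P.IsPrime] [hQ : Q.IsPrime] (hPD : IsDifferentialIdeal D P)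
    {A B : Set (DiffPoly m n k)}
    (hA : IsCharSet A (P : Set (DiffPoly m n k))) (hB : IsCharSet B (Q : Set (DiffPoly m n k)))
    (hAB : leaders A = leaders B) (hPQ : P ≤ Q) : P = Q := by
  have := h.wellFoundedLT
  have hLow : ∀ (f g : DiffPoly m n k) (u : DVar m n), IsLeader g u → (∀ v ∈ f.vars, v ≤ u) →
      f.degreeOf u < g.degreeOf u → IsReduced f g :=
    fun _ _ _ hu hf => h.isReduced_of_degreeOf_lt hu hf
  refine eq_of_le_of_algebraic hPQ {v | ∃ u ∈ leaders A, ∃ θ, u.act θ = v}ᶜ (fun v hv => ?_)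
    fun f hf hfN => ?_
  · obtain ⟨u, ⟨c, hc, hcu⟩, θ, rfl⟩ := not_not.1 hv
    obtain ⟨g, hgP, hg, hgc⟩ := h.exists_mem_supported_Iic_act hPD θ u (hA.1 hc) hcu.mem_supported
    refine ⟨g, hgP, hg, ?_⟩
    rw [hgc]
    exact pderiv_leader_notMem (fun _ _ => And.right) hLow (fun _ _ _ => IsReduced.mono)
      (Ideal.IsPrime.ne_top ‹_›) hA hc hcu
  · have hfree : ∀ c ∈ B, ∀ u, IsLeader c u → ∀ θ, u.act θ ∉ f.vars := by
      intro c hc u hu θ hmem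
      refine mem_supported.1 hfN hmem ⟨u, ?_, θ, rfl⟩
      rw [hAB]
      exact ⟨c, hc, hu⟩
    refine eq_zero_of_forall_red (fun _ _ => And.right) hLow hQ.ne_top hB hf fun c hc =>
      ⟨fun u hu θ _ => hfree c hc u hu θ, isAlgReduced_of_notMem_vars fun u hu => ?_⟩
    -- The trivial operator `θ = 0` excludes the leader itself, as algebraic reducedness needs.
    simpa only [DVar.zero_act] using hfree c hc u hu 0

end DiffAlg

theorem lemmal {k : Type*} [Field k] [CharZero k] {m n : ℕ}
    (D : Fin m → Derivation ℤ k k) (hD : ∀ i j a, D i (D j a) = D j (D i a))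
    [LinearOrder (DiffAlg.DVar m n)] (hrank : DiffAlg.IsRanking m n) :
    -- differential ideals of `k{y_1, …, y_n}`
    (∀ P Q : Ideal (DiffAlg.DiffPoly m n k), P.IsPrime → Q.IsPrime →
      DiffAlg.IsDifferentialIdeal D P → DiffAlg.IsDifferentialIdeal D Q →
      ∀ C₁ C₂ : Set (DiffAlg.DiffPoly m n k),
        DiffAlg.IsCharSet C₁ (P : Set (DiffAlg.DiffPoly m n k)) →
        DiffAlg.IsCharSet C₂ (Q : Set (DiffAlg.DiffPoly m n k)) →
        DiffAlg.leaders C₁ = DiffAlg.leaders C₂ → P ≤ Q → P = Q) ∧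
    -- algebraic ideals of `k[V]`, for any set `V` of derivatives, ordered by the ranking
    (∀ (V : Set (DiffAlg.DVar m n)) (P Q : Ideal (MvPolynomial V k)), P.IsPrime → Q.IsPrime →
      ∀ C₁ C₂ : Set (MvPolynomial V k),
        DiffAlg.IsAlgCharSet C₁ (P : Set (MvPolynomial V k)) →
        DiffAlg.IsAlgCharSet C₂ (Q : Set (MvPolynomial V k)) →
        DiffAlg.leaders C₁ = DiffAlg.leaders C₂ → P ≤ Q → P = Q) := by
  -- Well-foundedness passes to the restricted order on any set `V` of derivatives.
  have := hrank.wellFoundedLT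
  refine ⟨fun P Q _ _ hP _ C₁ C₂ h₁ h₂ hL hPQ => ?_, fun V P Q _ _ C₁ C₂ h₁ h₂ hL hPQ => ?_⟩
  · exact hrank.eq_of_leaders_eq_of_isCharSet hP h₁ h₂ hL hPQ
  · exact DiffAlg.eq_of_leaders_eq_of_isAlgCharSet h₁ h₂ hL hPQ
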